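/- **Boundedness of the sublevel sets of the action in $H^1$.** Let $d\ge 1$, let $D\subset\mathbb{R}^d$ be a nonempty bounded open set (for instance a bounded domain), and let $H^1(D)=W^{1,2}(D;\mathbb{C})$ with $\|\phi\|_{H^1}^2=\|\phi\|_{L^2}^2+\|\nabla\phi\|_{L^2}^2$. Let $\Omega\ge 0$, $\beta>0$, $\omega\in\mathbb{R}$, $p>1$, and $p<\frac{d+2}{d-2}$ if $d\ge 3$. Let $V\in L^\infty(D)$ be real-valued and assume that one of the following holds: (a) $d=1$ or $\Omega=0$, and $V(\mathbf{x})\ge 0$ for all $\mathbf{x}\in D$; (b) $d\ge 2$, $V(\mathbf{x})=\frac12\sum_{i=1}^d\gamma_i^2x_i^2$ on $D$ with $\gamma_1,\dots,\gamma_d>0$, and $\Omega<\min\{\gamma_1,\gamma_2\}$. Let $L_z=\mathrm{i}\,(x_2\partial_{x_1}-x_1\partial_{x_2})$ if $d\ge 2$ and $L_z=0$ if $d=1$, and put, for $\phi\in H^1(D)$, $$L_\Omega(\phi)=-\Omega\,\operatorname{Re}\int_D\overline{\phi}\,L_z\phi\,\mathrm{d}\mathbf{x},$$ $$S_{\Omega,\omega}(\phi)=\tfrac12\|\nabla\phi\|_{L^2}^2+\int_D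 V|\phi|^2\,\mathrm{d}\mathbf{x}+\frac{2\beta}{p+1}\|\phi\|_{L^{p+1}}^{p+1}+L_\Omega(\phi)+\omega\|\phi\|_{L^2}^2\in(-\infty,\infty]$$ (with the value $+\infty$ if $\phi\notin L^{p+1}(D)$, which does not occur when $H^1(D)\hookrightarrow L^{p+1}(D)$), and $$\lambda_0=\inf_{u\in H^1(D),\ \|u\|_{L^2}=1}\Big(\tfrac12\|\nabla u\|_{L^2}^2+\int_D V|u|^2\,\mathrm{d}\mathbf{x}+L_\Omega(u)\Big).$$ Assume $\omega<-\lambda_0$. Then for every $m\ge 0$ there is an $M>0$ such that $\|\phi\|_{H^1}\le M$ for every $\phi\in H^1(D)$ with $S_{\Omega,\omega}(\phi)\le m$. -/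

import Mathlib

open MeasureTheory

noncomputable section

/-- The space `L²(D; ℂ)` for `D ⊆ ℝᵈ`. -/
abbrev L2 {d : ℕ} (D : Set (EuclideanSpace ℝ (Fin d))) : Type :=
  Lp ℂ 2 (volume.restrict D)

/-- `ψ` is a test function on `D`: real-valued, smooth, with compact support inside `D`. -/
def IsTestFunction {d : ℕ} (D : Set (EuclideanSpace ℝ (Fin d)))
    (ψ : EuclideanSpace ℝ (Fin d) → ℝ) : Prop :=
  ContDiff ℝ (⊤ : ℕ∞) ψ ∧ HasCompactSupport ψ ∧ tsupport ψ ⊆ D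

/-- `g` is the weak partial derivative `∂ᵢ u` on `D`:
`∫_D u ∂ᵢψ = - ∫_D g ψ` for every test function `ψ` on `D`. -/
def IsWeakPartial {d : ℕ} (D : Set (EuclideanSpace ℝ (Fin d))) (i : Fin d)
    (u g : L2 D) : Prop :=
  ∀ ψ : EuclideanSpace ℝ (Fin d) → ℝ, IsTestFunction D ψ →
    ∫ x in D, (fderiv ℝ ψ x (EuclideanSpace.single i (1 : ℝ))) • u x
      = - ∫ x in D, ψ x • g x

theorem integrable_testFunction_smul {d : ℕ} {D : Set (EuclideanSpace ℝ (Fin d))}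
    {χ : EuclideanSpace ℝ (Fin d) → ℝ} (hc : Continuous χ) (hs : HasCompactSupport χ)
    (u : L2 D) : Integrable (fun x => χ x • u x) (volume.restrict D) := by
  have h1 : MemLp χ 2 (volume.restrict D) := hc.memLp_of_hasCompactSupport hs
  exact memLp_one_iff_integrable.1 ((Lp.memLp u).smul h1)

theorem IsTestFunction.integrable {d : ℕ} {D : Set (EuclideanSpace ℝ (Fin d))}
    {ψ : EuclideanSpace ℝ (Fin d) → ℝ} (hψ : IsTestFunction D ψ) (u : L2 D) :
    Integrable (fun x => ψ x • u x) (volume.restrict D) :=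
  integrable_testFunction_smul hψ.1.continuous hψ.2.1 u

theorem IsTestFunction.integrable_fderiv {d : ℕ} {D : Set (EuclideanSpace ℝ (Fin d))}
    {ψ : EuclideanSpace ℝ (Fin d) → ℝ} (hψ : IsTestFunction D ψ) (i : Fin d) (u : L2 D) :
    Integrable (fun x => (fderiv ℝ ψ x (EuclideanSpace.single i (1 : ℝ))) • u x)
      (volume.restrict D) :=
  integrable_testFunction_smul
    ((hψ.1.continuous_fderiv (by simp)).clm_apply continuous_const)
    (hψ.2.1.fderiv_apply (𝕜 := ℝ) _) u

/-- The Sobolev space `H¹(D) = W^{1,2}(D; ℂ)`. An element is the pair `(u, ∇u)` of a function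
`u ∈ L²(D)` and its weak gradient in `L²(D)ᵈ`, which is determined by `u`
(see `IsWeakPartial.unique`). The inherited norm is
`‖u‖_{H¹} = (‖u‖²_{L²} + ∑ᵢ ‖∂ᵢu‖²_{L²})^{1/2}` (see `H1.norm_sq`). -/
def H1 {d : ℕ} (D : Set (EuclideanSpace ℝ (Fin d))) :
    Submodule ℂ (WithLp 2 (L2 D × PiLp 2 (fun _ : Fin d => L2 D))) where
  carrier := {w | ∀ i, IsWeakPartial D i w.fst (w.snd i)}
  zero_mem' := by
    intro i ψ hψ
    have h0 : ∀ᵐ x ∂(volume.restrict D), (0 : L2 D) x = 0 := Lp.coeFn_zero _ _ _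
    have e1 : ∫ x in D, (fderiv ℝ ψ x (EuclideanSpace.single i (1 : ℝ))) • (0 : L2 D) x = 0 :=
      integral_eq_zero_of_ae (by filter_upwards [h0] with x hx; rw [hx, smul_zero]; rfl)
    have e2 : ∫ x in D, ψ x • (0 : L2 D) x = 0 :=
      integral_eq_zero_of_ae (by filter_upwards [h0] with x hx; rw [hx, smul_zero]; rfl)
    change ∫ x in D, (fderiv ℝ ψ x (EuclideanSpace.single i (1 : ℝ))) • (0 : L2 D) x
      = - ∫ x in D, ψ x • (0 : L2 D) x
    rw [e1, e2, neg_zero]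
  add_mem' := by
    intro v w hv hw i ψ hψ
    have key : ∀ (χ : EuclideanSpace ℝ (Fin d) → ℝ) (a b : L2 D),
        Integrable (fun x => χ x • a x) (volume.restrict D) →
        Integrable (fun x => χ x • b x) (volume.restrict D) →
        ∫ x in D, χ x • (a + b : L2 D) x = (∫ x in D, χ x • a x) + ∫ x in D, χ x • b x := by
      intro χ a b ha hb
      rw [← integral_add ha hb]
      refine integral_congr_ae ?_
      filter_upwards [Lp.coeFn_add a b] with x hx
      simp only [hx, Pi.add_apply, smul_add]
    change ∫ x in D, (fderiv ℝ ψ x (EuclideanSpace.single i (1 : ℝ))) •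
        (v.fst + w.fst : L2 D) x = - ∫ x in D, ψ x • (v.snd i + w.snd i : L2 D) x
    have hv' := hv i ψ hψ
    have hw' := hw i ψ hψ
    rw [key _ _ _ (hψ.integrable_fderiv i _) (hψ.integrable_fderiv i _),
      key _ _ _ (hψ.integrable _) (hψ.integrable _), hv', hw', neg_add]
  smul_mem' := by
    intro c w hw i ψ hψ
    have key : ∀ (χ : EuclideanSpace ℝ (Fin d) → ℝ) (a : L2 D),
        ∫ x in D, χ x • (c • a : L2 D) x = c * ∫ x in D, χ x • a x := by
      intro χ a
      rw [← integral_const_mul]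
      refine integral_congr_ae ?_
      filter_upwards [Lp.coeFn_smul c a] with x hx
      simp only [hx, Pi.smul_apply, smul_eq_mul, Complex.real_smul]
      ring
    change ∫ x in D, (fderiv ℝ ψ x (EuclideanSpace.single i (1 : ℝ))) • (c • w.fst : L2 D) x
      = - ∫ x in D, ψ x • (c • w.snd i : L2 D) x
    rw [key, key, hw i ψ hψ]
    ring

theorem IsWeakPartial.unique {d : ℕ} {D : Set (EuclideanSpace ℝ (Fin d))} (hD : IsOpen D)
    {i : Fin d} {u g h : L2 D} (hg : IsWeakPartial D i u g) (hh : IsWeakPartial D i u h) :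
    g = h := by
  have hloc : ∀ a : L2 D, LocallyIntegrableOn a D volume := fun a =>
    locallyIntegrableOn_of_locallyIntegrable_restrict
      ((Lp.memLp a).locallyIntegrable (by norm_num))
  have key := hD.ae_eq_zero_of_integral_contDiff_smul_eq_zero (μ := volume)
    (f := fun x => g x - h x) ((hloc g).sub (hloc h)) (by
      intro ψ h1 h2 h3
      have hψ : IsTestFunction D ψ := ⟨h1, h2, h3⟩
      have e : ∫ x in D, ψ x • g x = ∫ x in D, ψ x • h x := by
        have := (hg ψ hψ).symm.trans (hh ψ hψ)
        exact neg_injective this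
      rw [← setIntegral_eq_integral_of_forall_compl_eq_zero (s := D)]
      · simp only [smul_sub]
        rw [integral_sub (hψ.integrable g) (hψ.integrable h), e, sub_self]
      · intro x hx
        rw [image_eq_zero_of_notMem_tsupport (fun hx' => hx (h3 hx')), zero_smul])
  refine Lp.ext ?_
  rw [Filter.EventuallyEq, ae_restrict_iff' hD.measurableSet]
  filter_upwards [key] with x hx hxD
  exact sub_eq_zero.1 (hx hxD)

namespace H1

variable {d : ℕ} {D : Set (EuclideanSpace ℝ (Fin d))}

/-- The function `u ∈ L²(D)` underlying an element of `H¹(D)`. -/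
def fn (u : H1 D) : L2 D := u.1.fst

/-- The weak partial derivative `∂ᵢu ∈ L²(D)`. -/
def partialDeriv (u : H1 D) (i : Fin d) : L2 D := u.1.snd i

theorem norm_sq (u : H1 D) : ‖u‖ ^ 2 = ‖fn u‖ ^ 2 + ∑ i, ‖partialDeriv u i‖ ^ 2 := by
  rw [Submodule.coe_norm, WithLp.prod_norm_sq_eq_of_L2, PiLp.norm_sq_eq_of_L2]
  rfl

/-- `‖∇u‖²_{L²}`. -/
def gradSq (u : H1 D) : ℝ := ∑ i, ‖partialDeriv u i‖ ^ 2

/-- `∫_D V |u|²`. -/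
def potential (V : EuclideanSpace ℝ (Fin d) → ℝ) (u : H1 D) : ℝ :=
  ∫ x in D, V x * ‖fn u x‖ ^ 2

/-- `‖u‖^{p+1}_{L^{p+1}} = ∫_D |u|^{p+1}`, as an extended nonnegative number: it is `∞` exactly
when `u ∉ L^{p+1}(D)`. -/
def powerIntegral (p : ℝ) (u : H1 D) : ENNReal :=
  ∫⁻ x in D, ‖fn u x‖ₑ ^ (p + 1)

/-- `L_z u = 𝐢 (x₂ ∂₁u - x₁ ∂₂u)` if `d ≥ 2`, and `L_z u = 0` if `d = 1`
(the coordinates `x₁, x₂` have the indices `0, 1`). -/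
def angularMomentum (u : H1 D) (x : EuclideanSpace ℝ (Fin d)) : ℂ :=
  if h : 2 ≤ d then
    Complex.I * ((x ⟨1, by omega⟩ : ℂ) * partialDeriv u ⟨0, by omega⟩ x
      - (x ⟨0, by omega⟩ : ℂ) * partialDeriv u ⟨1, by omega⟩ x)
  else 0

/-- `L_Ω(u) = -Ω Re ∫_D ū L_z u`. -/
def rotation (Ω : ℝ) (u : H1 D) : ℝ :=
  -Ω * (∫ x in D, (starRingEnd ℂ) (fn u x) * angularMomentum u x).re

/-- `½ ‖∇u‖² + ∫_D V |u|² + L_Ω(u)`. -/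
def quadraticEnergy (V : EuclideanSpace ℝ (Fin d) → ℝ) (Ω : ℝ) (u : H1 D) : ℝ :=
  1 / 2 * gradSq u + potential V u + rotation Ω u

/-- The action functional
`S(u) = ½ ‖∇u‖² + ∫_D V |u|² + 2β/(p+1) ‖u‖^{p+1}_{L^{p+1}} + L_Ω(u) + ω ‖u‖²`,
with the value `+∞` when `β > 0` and `u ∉ L^{p+1}(D)`. -/
def action (V : EuclideanSpace ℝ (Fin d) → ℝ) (Ω β p ω : ℝ) (u : H1 D) : EReal :=
  ((quadraticEnergy V Ω u + ω * ‖fn u‖ ^ 2 : ℝ) : EReal)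
    + ((2 * β / (p + 1) : ℝ) : EReal) * ((powerIntegral p u : ENNReal) : EReal)

end H1

/-- `λ₀ = inf { ½ ‖∇u‖² + ∫_D V |u|² + L_Ω(u) : u ∈ H¹(D), ‖u‖_{L²} = 1 }`. -/
def lambda0 {d : ℕ} (D : Set (EuclideanSpace ℝ (Fin d)))
    (V : EuclideanSpace ℝ (Fin d) → ℝ) (Ω : ℝ) : ℝ :=
  sInf {e : ℝ | ∃ u : H1 D, ‖H1.fn u‖ = 1 ∧ H1.quadraticEnergy V Ω u = e}

/-- The sublevel set `S_{≤ m} = {u ∈ H¹(D) : S(u) ≤ m}`. -/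
def actionSublevel {d : ℕ} (D : Set (EuclideanSpace ℝ (Fin d)))
    (V : EuclideanSpace ℝ (Fin d) → ℝ) (Ω β p ω m : ℝ) : Set (H1 D) :=
  {u | H1.action V Ω β p ω u ≤ (m : EReal)}

/-- The harmonic trap `½ ∑ᵢ γᵢ² xᵢ²`. -/
def harmonicTrap {d : ℕ} (γ : Fin d → ℝ) (x : EuclideanSpace ℝ (Fin d)) : ℝ :=
  1 / 2 * ∑ i, γ i ^ 2 * x i ^ 2

/-- The standing assumption on the exponent `p`, the potential `V` and the rotation speed `Ω`. -/
structure BasicAssumption {d : ℕ} (D : Set (EuclideanSpace ℝ (Fin d)))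
    (V : EuclideanSpace ℝ (Fin d) → ℝ) (Ω p : ℝ) : Prop where
  one_lt_p : 1 < p
  p_lt : 3 ≤ d → p < ((d : ℝ) + 2) / ((d : ℝ) - 2)
  memLp : MemLp V ⊤ (volume.restrict D)
  cases_ab :
    ((d = 1 ∨ Ω = 0) ∧ ∀ x ∈ D, 0 ≤ V x) ∨
    (∃ (h : 2 ≤ d) (γ : Fin d → ℝ), (∀ i, 0 < γ i) ∧ (∀ x ∈ D, V x = harmonicTrap γ x) ∧
      Ω < min (γ ⟨0, by omega⟩) (γ ⟨1, by omega⟩))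

end

namespace H1

variable {d : ℕ} {D : Set (EuclideanSpace ℝ (Fin d))}

/-! Only two terms of the action can be negative, the rotation and `ω‖φ‖²`, and the nonlinear term
pays for both. On a bounded domain Young's inequality bounds the rotation by a quarter of `‖∇φ‖²`
plus a multiple of the mass (`abs_rotation_le`). Since `p + 1 > 2` and `D` has finite volume, any
multiple of the mass is absorbed by the `L^{p+1}` term up to a constant
(`exists_mul_sq_le_rpow_add`, integrated over `D`). With `V ≥ 0`, a quarter of `‖φ‖²_{H¹}` survives
below a constant. -/

theorem gradSq_nonneg (u : H1 D) : 0 ≤ gradSq u :=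
  Finset.sum_nonneg fun _ _ => sq_nonneg _

theorem potential_nonneg (hD : MeasurableSet D) {V : EuclideanSpace ℝ (Fin d) → ℝ}
    (hV : ∀ x ∈ D, 0 ≤ V x) (u : H1 D) : 0 ≤ potential V u :=
  setIntegral_nonneg hD fun x hx => mul_nonneg (hV x hx) (sq_nonneg _)

end H1

theorem L2.integrable_norm_sq {d : ℕ} {D : Set (EuclideanSpace ℝ (Fin d))} (f : L2 D) :
    Integrable (fun x => ‖f x‖ ^ 2) (volume.restrict D) :=
  (memLp_two_iff_integrable_sq_norm (Lp.aestronglyMeasurable f)).1 (Lp.memLp f)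

theorem L2.integral_norm_sq {d : ℕ} {D : Set (EuclideanSpace ℝ (Fin d))} (f : L2 D) :
    ∫ x in D, ‖f x‖ ^ 2 = ‖f‖ ^ 2 := by
  have h := L2.inner_def (𝕜 := ℂ) f f
  simp only [inner_self_eq_norm_sq_to_K] at h
  have h' : ((‖f‖ ^ 2 : ℝ) : ℂ) = ((∫ x in D, ‖f x‖ ^ 2 : ℝ) : ℂ) := by
    rw [← integral_complex_ofReal]
    simpa using h
  exact (Complex.ofReal_injective h').symm

namespace H1

variable {d : ℕ} {D : Set (EuclideanSpace ℝ (Fin d))}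

/-- On a bounded set the rotation term is controlled by a quarter of the Dirichlet energy and a
multiple of the mass. -/
theorem abs_rotation_le (hD : MeasurableSet D) {R Ω : ℝ} (hΩ : 0 ≤ Ω)
    (hR : ∀ x ∈ D, ‖x‖ ≤ R) (u : H1 D) :
    |rotation Ω u| ≤ 1 / 4 * gradSq u + 2 * (Ω * R) ^ 2 * ‖fn u‖ ^ 2 := by
  by_cases h : 2 ≤ d
  · set i₀ : Fin d := ⟨0, by omega⟩ with hi₀
    set i₁ : Fin d := ⟨1, by omega⟩ with hi₁
    have hint : ∀ f : L2 D, Integrable (fun x => ‖f x‖ ^ 2) (volume.restrict D) :=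
      L2.integrable_norm_sq
    have hgrad : Integrable (fun x => 1 / 4 *
        (‖partialDeriv u i₀ x‖ ^ 2 + ‖partialDeriv u i₁ x‖ ^ 2)) (volume.restrict D) :=
      ((hint _).add (hint _)).const_mul _
    -- `Ω` stays under the integral so that Young's inequality applies pointwise with the weight `Ω
    -- * R`.
    have hbound : ‖∫ x in D, (Ω : ℂ) * ((starRingEnd ℂ) (fn u x) * angularMomentum u x)‖ ≤
        ∫ x in D, (2 * (Ω * R) ^ 2 * ‖fn u x‖ ^ 2 + 1 / 4 *
          (‖partialDeriv u i₀ x‖ ^ 2 + ‖partialDeriv u i₁ x‖ ^ 2)) := by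
      refine norm_integral_le_of_norm_le (((hint _).const_mul _).add hgrad) ?_
      filter_upwards [ae_restrict_mem hD] with x hx
      have hc : ∀ i, ‖(x i : ℂ)‖ ≤ R := fun i => by
        rw [Complex.norm_real]
        exact (PiLp.norm_apply_le x i).trans (hR x hx)
      have hL : ‖angularMomentum u x‖ ≤
          R * ‖partialDeriv u i₀ x‖ + R * ‖partialDeriv u i₁ x‖ := by
        rw [angularMomentum, dif_pos h, norm_mul, Complex.norm_I, one_mul]
        refine (norm_sub_le _ _).trans ?_
        rw [norm_mul, norm_mul]
        gcongr
        · exact hc _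
        · exact hc _
      rw [norm_mul, norm_mul, Complex.norm_real, Real.norm_of_nonneg hΩ, RCLike.norm_conj]
      have h1 : Ω * (‖fn u x‖ * ‖angularMomentum u x‖) ≤
          Ω * (‖fn u x‖ * (R * ‖partialDeriv u i₀ x‖ + R * ‖partialDeriv u i₁ x‖)) := by
        gcongr
      -- Each square gives `ΩR·a·b ≤ (ΩR·a)² + b²/4`; the two derivatives together produce the
      -- factor 2.
      nlinarith [sq_nonneg (Ω * R * ‖fn u x‖ - ‖partialDeriv u i₀ x‖ / 2),
        sq_nonneg (Ω * R * ‖fn u x‖ - ‖partialDeriv u i₁ x‖ / 2)]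
    rw [integral_const_mul, norm_mul, Complex.norm_real, Real.norm_of_nonneg hΩ,
      integral_add ((hint _).const_mul _) hgrad,
      integral_const_mul, integral_const_mul, integral_add (hint _) (hint _),
      L2.integral_norm_sq, L2.integral_norm_sq, L2.integral_norm_sq] at hbound
    have hsum : ‖partialDeriv u i₀‖ ^ 2 + ‖partialDeriv u i₁‖ ^ 2 ≤ gradSq u := by
      rw [← Finset.sum_pair (f := fun i => ‖partialDeriv u i‖ ^ 2)
        (show i₀ ≠ i₁ by simp [hi₀, hi₁])]
      exact Finset.sum_le_sum_of_subset_of_nonneg (Finset.subset_univ _)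
        fun _ _ _ => sq_nonneg _
    rw [rotation, abs_mul, abs_neg, abs_of_nonneg hΩ]
    have := mul_le_mul_of_nonneg_left (Complex.abs_re_le_norm
      (∫ x in D, (starRingEnd ℂ) (fn u x) * angularMomentum u x)) hΩ
    linarith
  · have h0 : rotation Ω u = 0 := by simp [rotation, angularMomentum, h]
    rw [h0, abs_zero]
    have := gradSq_nonneg u
    positivity

end H1

/-- A higher power absorbs the square up to a constant. -/
theorem exists_mul_sq_le_rpow_add {p c K : ℝ} (hp : 1 < p) (hc : 0 < c) (hK : 0 ≤ K) :
    ∃ C : ℝ, 0 ≤ C ∧ ∀ t : ℝ, 0 ≤ t → K * t ^ 2 ≤ c * t ^ (p + 1) + C := by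
  -- Threshold with `c * s ^ (p - 1) = K`: beyond it the power dominates, below it `K * s ^ 2`
  -- bounds the square.
  set s : ℝ := (K / c) ^ (p - 1)⁻¹
  have hs : 0 ≤ s := Real.rpow_nonneg (by positivity) _
  have hsp : s ^ (p - 1) = K / c := Real.rpow_inv_rpow (by positivity) (by linarith)
  refine ⟨K * s ^ 2, by positivity, fun t ht => ?_⟩
  rcases le_total t s with h | h
  · have h1 : K * t ^ 2 ≤ K * s ^ 2 := by gcongr
    have h2 : 0 ≤ c * t ^ (p + 1) := by positivity
    linarith
  · have h1 : K / c ≤ t ^ (p - 1) := hsp ▸ Real.rpow_le_rpow hs h (by linarith)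
    have h2 : t ^ (p + 1) = t ^ (p - 1) * t ^ 2 := by
      rw [← Real.rpow_natCast t 2, ← Real.rpow_add_of_nonneg ht (by linarith) (by norm_num)]
      congr 1
      push_cast
      ring
    have h3 : K * t ^ 2 ≤ c * t ^ (p + 1) := by
      rw [h2, ← mul_assoc]
      gcongr
      rwa [div_le_iff₀' hc] at h1
    have h4 : 0 ≤ K * s ^ 2 := by positivity
    linarith

namespace H1

variable {d : ℕ} {D : Set (EuclideanSpace ℝ (Fin d))}

theorem integrable_rpow {p : ℝ} (hp : 1 < p) {u : H1 D} (h : powerIntegral p u ≠ ⊤) :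
    Integrable (fun x => ‖fn u x‖ ^ (p + 1)) (volume.restrict D) := by
  refine ⟨((Lp.aestronglyMeasurable (fn u)).norm.aemeasurable.pow_const
    _).aestronglyMeasurable, ?_⟩
  rw [hasFiniteIntegral_iff_enorm]
  refine lt_of_eq_of_lt (lintegral_congr fun x => ?_) (lt_top_iff_ne_top.2 h)
  rw [Real.enorm_rpow_of_nonneg (norm_nonneg _) (by linarith), enorm_norm]

theorem integral_rpow_eq_toReal {p : ℝ} (hp : 1 < p) (u : H1 D) :
    ∫ x in D, ‖fn u x‖ ^ (p + 1) = (powerIntegral p u).toReal := by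
  rw [integral_eq_lintegral_of_nonneg_ae (ae_of_all _ fun x => by positivity)
    ((Lp.aestronglyMeasurable (fn u)).norm.aemeasurable.pow_const _).aestronglyMeasurable]
  congr 1
  refine lintegral_congr fun x => ?_
  rw [← ENNReal.ofReal_rpow_of_nonneg (norm_nonneg _) (by linarith), ofReal_norm]

/-- On a sublevel set the power integral is finite and the bound on the action is an inequality
of real numbers. -/
theorem real_action_le {V : EuclideanSpace ℝ (Fin d) → ℝ} {Ω β p ω m : ℝ} (hp : 1 < p)
    (hβ : 0 < β) {u : H1 D} (hu : u ∈ actionSublevel D V Ω β p ω m) :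
    powerIntegral p u ≠ ⊤ ∧
      quadraticEnergy V Ω u + ω * ‖fn u‖ ^ 2
        + 2 * β / (p + 1) * (powerIntegral p u).toReal ≤ m := by
  have hc : 0 < 2 * β / (p + 1) := by
    have : 0 < p + 1 := by linarith
    positivity
  have hu' : action V Ω β p ω u ≤ (m : EReal) := hu
  rw [action] at hu'
  -- An infinite power integral with a positive coefficient would force the action to be `⊤`.
  have hfin : powerIntegral p u ≠ ⊤ := by
    intro h
    rw [h, EReal.coe_ennreal_top, EReal.coe_mul_top_of_pos hc, EReal.coe_add_top] at hu'
    exact absurd hu' (not_le.2 (EReal.coe_lt_top m))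
  refine ⟨hfin, ?_⟩
  rw [← ENNReal.ofReal_toReal hfin, EReal.coe_ennreal_ofReal,
    max_eq_left ENNReal.toReal_nonneg, ← EReal.coe_mul, ← EReal.coe_add,
    EReal.coe_le_coe_iff] at hu'
  exact hu'

end H1

theorem BasicAssumption.nonneg {d : ℕ} {D : Set (EuclideanSpace ℝ (Fin d))}
    {V : EuclideanSpace ℝ (Fin d) → ℝ} {Ω p : ℝ} (hA : BasicAssumption D V Ω p) :
    ∀ x ∈ D, 0 ≤ V x := by
  rcases hA.cases_ab with ⟨_, h⟩ | ⟨_, γ, _, h, _⟩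
  · exact h
  · intro x hx
    rw [h x hx, harmonicTrap]
    positivity

theorem mainTheorem6 (d : ℕ) (hd : 1 ≤ d) (D : Set (EuclideanSpace ℝ (Fin d)))
    (hD_open : IsOpen D) (hD_bdd : Bornology.IsBounded D) (hD_ne : D.Nonempty)
    (V : EuclideanSpace ℝ (Fin d) → ℝ) (Ω β p ω : ℝ) (hΩ : 0 ≤ Ω) (hβ : 0 < β)
    (hA : BasicAssumption D V Ω p) (hω : ω < -lambda0 D V Ω) (m : ℝ) (hm : 0 ≤ m) :
    ∃ M : ℝ, 0 < M ∧ ∀ φ ∈ actionSublevel D V Ω β p ω m, ‖φ‖ ≤ M := by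
  have hp := hA.one_lt_p
  obtain ⟨R, hR⟩ := hD_bdd.exists_norm_le
  have hDm := hD_open.measurableSet
  have hc : 0 < 2 * β / (p + 1) := by
    have : 0 < p + 1 := by linarith
    positivity
  -- The summands pay for the rotation, for `ω‖φ‖²`, and for a quarter of the mass to match the
  -- quarter of `‖∇φ‖²` left over.
  have hK : 0 ≤ 2 * (Ω * R) ^ 2 + |ω| + 1 / 4 := by positivity
  obtain ⟨C, hC, hYoung⟩ := exists_mul_sq_le_rpow_add hp hc hK
  set v : ℝ := volume.real D
  have hv : 0 ≤ v := measureReal_nonneg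
  -- The 4 clears the surviving quarter; the `+ 1` only makes the bound strictly positive.
  refine ⟨√(4 * (m + C * v)) + 1, by positivity, fun φ hφ => ?_⟩
  obtain ⟨hfin, hle⟩ := H1.real_action_le hp hβ hφ
  have : IsFiniteMeasure (volume.restrict D) :=
    isFiniteMeasure_restrict.2 hD_bdd.measure_lt_top.ne
  have hmass : (2 * (Ω * R) ^ 2 + |ω| + 1 / 4) * ‖H1.fn φ‖ ^ 2 ≤
      2 * β / (p + 1) * (H1.powerIntegral p φ).toReal + C * v := by
    have hi := (H1.integrable_rpow hp hfin).const_mul (2 * β / (p + 1))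
    have := integral_mono (μ := volume.restrict D)
      ((L2.integrable_norm_sq (H1.fn φ)).const_mul _)
      (hi.add (integrable_const C)) fun x => hYoung _ (norm_nonneg (H1.fn φ x))
    simp only [Pi.add_apply] at this
    rw [integral_const_mul, L2.integral_norm_sq, integral_add hi (integrable_const C),
      integral_const_mul, H1.integral_rpow_eq_toReal hp, setIntegral_const, smul_eq_mul,
      mul_comm _ C] at this
    exact this
  have hrot := neg_le_of_abs_le (H1.abs_rotation_le hDm hΩ hR φ)
  have hpot := H1.potential_nonneg hDm hA.nonneg φ
  have hom : -|ω| * ‖H1.fn φ‖ ^ 2 ≤ ω * ‖H1.fn φ‖ ^ 2 :=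
    mul_le_mul_of_nonneg_right (neg_abs_le ω) (sq_nonneg _)
  have hnorm : ‖φ‖ ^ 2 = ‖H1.fn φ‖ ^ 2 + H1.gradSq φ := H1.norm_sq φ
  rw [H1.quadraticEnergy] at hle
  -- Summing the estimates cancels the power integral and leaves `¼‖∇φ‖² + ¼‖φ‖²_{L²} ≤ m + C * v`.
  have hsq : ‖φ‖ ^ 2 ≤ 4 * (m + C * v) := by
    linarith
  exact (Real.le_sqrt_of_sq_le hsq).trans (by linarith)
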